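/- Let $m,n\ge 1$ be integers with $m+n$ even. Let $G$ be a Ferrers graph whose vertex set is partitioned as $R\cup C$ with $R=\{r_1,\dots,r_m\}$ and $C=\{c_1,\dots,c_n\}$ (so $|R|=m$, $|C|=n$); that is, $G$ is a finite simple connected bipartite graph with parts $R$ and $C$ such that $r_1c_n$ and $r_mc_1$ are edges and, whenever $r_pc_q$ is an edge, $r_ic_j$ is an edge for all $1\le i\le p$ and $1\le j\le q$. Let $\lambda=(\lambda_1,\dots,\lambda_m)$ be the associated partition and $\lambda'=(\lambda'_1,\dots,\lambda'_n)$ its dual partition, where $\lambda_i=\deg_G(r_i)$ and $\lambda'_j=\deg_G(c_j)$. Put $p_i=\lambda_i-\lambda_{i+1}$ for $1\le i\le m$, with $\lambda_{m+1}=0$, and $q_j=\lambda'_j-\lambda'_{j+1}$ for $1\le j\le n$, with $\lambda'_{n+1}=0$. Let $\tau_o(G)$ denote the number of odd spanning trees of $G$, i.e. spanning trees of $G$ in which every vertex has odd degree. Then $$\tau_o(G)=\frac{1}{2^{m+n}}\left(\sum_{k_1=0}^{p_1}\cdots\sum_{k_m=0}^{p_m}\Big(\prod_{t=1}^{m}\binom{p_t}{k_t}\Big)\prod_{i=2}^{m}\Big(2\sum_{t=i}^{m}k_t-\lambda_i\Big)\right)\left(\sum_{\ell_1=0}^{q_1}\cdots\sum_{\ell_n=0}^{q_n}\Big(\prod_{s=1}^{n}\binom{q_s}{\ell_s}\Big)\prod_{j=2}^{n}\Big(2\sum_{s=j}^{n}\ell_s-\lambda'_j\Big)\right).$$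 -/

import Mathlib

/-- `G` is a Ferrers graph with row vertices `r 0, …, r (m - 1)` and column vertices
`c 0, …, c (n - 1)` (indices start at `0`). -/
structure IsFerrersGraph {V : Type*} (G : SimpleGraph V) {m n : ℕ}
    (r : Fin m → V) (c : Fin n → V) : Prop where
  connected : G.Connected
  /-- The `r i` and `c j` list every vertex exactly once. -/
  partition : Function.Bijective (Sum.elim r c)
  /-- `G` is bipartite with parts `R = {r i}` and `C = {c j}`. -/
  bipartite : G.IsBipartiteWith (Set.range r) (Set.range c)
  rows_pos : 0 < m
  cols_pos : 0 < n
  /-- The first row vertex is adjacent to the last column vertex. -/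
  adj_first_last : G.Adj (r ⟨0, rows_pos⟩) (c ⟨n - 1, Nat.sub_one_lt_of_lt cols_pos⟩)
  /-- The last row vertex is adjacent to the first column vertex. -/
  adj_last_first : G.Adj (r ⟨m - 1, Nat.sub_one_lt_of_lt rows_pos⟩) (c ⟨0, cols_pos⟩)
  /-- The edges are closed under decreasing either index. -/
  adj_of_le : ∀ (p i : Fin m) (q j : Fin n), G.Adj (r p) (c q) → i ≤ p → j ≤ q → G.Adj (r i) (c j)

open Classical in
/-- The number of odd spanning trees of `G`: spanning trees (subgraphs on the full vertex set
that are trees) all of whose vertices have odd degree. -/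
noncomputable def numOddSpanningTrees {V : Type*} [Fintype V] (G : SimpleGraph V) : ℕ :=
  Set.ncard {T : SimpleGraph V | T ≤ G ∧ T.IsTree ∧ ∀ v, Odd (T.degree v)}

/-- For `a = (a 0, …, a (m - 1))`, the difference `a i - a (i + 1)`, where `a m` means `0`.
It is only used for weakly decreasing `a`, so the subtraction does not truncate. -/
def partDiff {m : ℕ} (a : Fin m → ℕ) (i : Fin m) : ℕ :=
  a i - if h : (i : ℕ) + 1 < m then a ⟨i + 1, h⟩ else 0

/-! Attach a sign ε_v to every vertex. For a spanning tree T, the average over all ε of ∏ ε_v^(deg v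
+ 1) is 1 if every degree is odd and 0 otherwise. So τ_o(G) is the average of ∏ ε_v times the degree
enumerator of spanning trees at ε (`two_pow_card_mul_numOddSpanningTrees`).

By a weighted matrix-tree theorem (`sum_spanningTrees_prod_pow_degree`) the enumerator is a
determinant, which for a Ferrers graph becomes triangular after one column and one set of row
operations (`IsFerrersGraph.det_rootedLaplacian`). Since ε_v² = 1, what remains is the product over
all rows but the first of the sum of their column signs, times the same with rows and columns
exchanged. The first factor involves only column signs and the second only row signs, so the average
splits into two sums.

In each sum, columns with the same last row play the same role. There are p_t columns ending at row
t. If k_t of them are positive, which happens in ∏ C(p_t, k_t) ways, the sign sum of row i is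
2∑_{t≥i} k_t − λ_i (`sum_sign_vectors_ferrers`). -/

/-! ### Rooted trees as parent functions -/

/-- `f` is the parent function of a tree rooted at `ρ`: away from `ρ`, iterating `f` leads
to `ρ`. -/
def IsParentFun {V : Type*} (ρ : V) (f : V → V) : Prop :=
  f ρ = ρ ∧ ∃ rank : V → ℕ, ∀ v, v ≠ ρ → rank (f v) < rank v

/-- The graph joining every vertex to its image under `f`. -/
def parentGraph {V : Type*} (f : V → V) : SimpleGraph V :=
  SimpleGraph.fromRel fun u v => f u = v

section ParentGraph

variable {V : Type*} {ρ : V} {f g : V → V}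

theorem parentGraph_adj {u v : V} :
    (parentGraph f).Adj u v ↔ u ≠ v ∧ (f u = v ∨ f v = u) :=
  SimpleGraph.fromRel_adj _ _ _

theorem IsParentFun.apply_ne (hf : IsParentFun ρ f) {v : V} (hv : v ≠ ρ) : f v ≠ v := by
  obtain ⟨-, rank, h⟩ := hf
  intro h'
  have := h v hv
  rw [h'] at this
  exact lt_irrefl _ this

theorem IsParentFun.apply_apply_ne (hf : IsParentFun ρ f) {v : V} (hv : v ≠ ρ) :
    f (f v) ≠ v := by
  obtain ⟨h0, rank, h⟩ := hf
  intro h'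
  by_cases hfv : f v = ρ
  · rw [hfv, h0] at h'
    exact hv h'.symm
  · have h1 := h v hv
    have h2 := h (f v) hfv
    rw [h'] at h2
    omega

theorem IsParentFun.parentGraph_connected (hf : IsParentFun ρ f) :
    (parentGraph f).Connected := by
  have hf' := hf
  obtain ⟨-, rank, h⟩ := hf'
  have key : ∀ k v, rank v = k → (parentGraph f).Reachable v ρ := by
    intro k
    induction k using Nat.strong_induction_on with
    | _ k ih =>
      intro v hk
      by_cases hv : v = ρ
      · subst hv
        exact SimpleGraph.Reachable.refl _
      · have hadj : (parentGraph f).Adj v (f v) :=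
          parentGraph_adj.2 ⟨(hf.apply_ne hv).symm, Or.inl rfl⟩
        exact hadj.reachable.trans (ih _ (hk ▸ h v hv) _ rfl)
  have : Nonempty V := ⟨ρ⟩
  exact ⟨fun u v => (key _ u rfl).trans (key _ v rfl).symm⟩

theorem IsParentFun.parentGraph_isTree [Finite V] (hf : IsParentFun ρ f) :
    (parentGraph f).IsTree := by
  classical
  have := Fintype.ofFinite V
  rw [SimpleGraph.isTree_iff_connected_and_card]
  refine ⟨hf.parentGraph_connected, le_antisymm ?_
    hf.parentGraph_connected.card_vert_le_card_edgeSet_add_one⟩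
  have hsub : (parentGraph f).edgeSet ⊆
      ((Finset.univ.erase ρ).image fun v => s(v, f v) : Finset (Sym2 V)) := by
    intro e
    induction e using Sym2.ind with
    | _ u v =>
      rw [SimpleGraph.mem_edgeSet, parentGraph_adj]
      rintro ⟨hne, h⟩
      rw [Finset.mem_coe, Finset.mem_image]
      rcases h with h | h
      · refine ⟨u, ?_, by rw [h]⟩
        simp only [Finset.mem_erase, Finset.mem_univ, and_true]
        rintro rfl
        exact hne (hf.1.symm.trans h)
      · refine ⟨v, ?_, by rw [h, Sym2.eq_swap]⟩
        simp only [Finset.mem_erase, Finset.mem_univ, and_true]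
        rintro rfl
        exact hne (h.symm.trans hf.1)
  have h1 := Set.ncard_le_ncard hsub (Finset.finite_toSet _)
  rw [Set.ncard_coe_finset] at h1
  have h2 := h1.trans Finset.card_image_le
  rw [Finset.card_erase_of_mem (Finset.mem_univ _), Finset.card_univ] at h2
  have h3 : 0 < Fintype.card V := Fintype.card_pos_iff.2 ⟨ρ⟩
  rw [Nat.card_coe_set_eq, Nat.card_eq_fintype_card]
  omega

theorem IsParentFun.parentGraph_le {G : SimpleGraph V} (hf : IsParentFun ρ f) :
    parentGraph f ≤ G ↔ ∀ v, v ≠ ρ → G.Adj v (f v) := by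
  constructor
  · intro h v hv
    exact h (parentGraph_adj.2 ⟨(hf.apply_ne hv).symm, Or.inl rfl⟩)
  · intro h u v huv
    obtain ⟨hne, h' | h'⟩ := parentGraph_adj.1 huv
    · have hu : u ≠ ρ := by
        rintro rfl
        exact hne (hf.1.symm.trans h')
      exact h' ▸ h u hu
    · have hv : v ≠ ρ := by
        rintro rfl
        exact hne (h'.symm.trans hf.1)
      exact (h' ▸ h v hv : G.Adj v u).symm

/-- Induction on rank: if `v` were the `g`-parent of `f v`, then, as `f` and `g` agree at `f v`, it
would also be its `f`-parent, giving a 2-cycle of `f`. -/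
theorem IsParentFun.eq_of_parentGraph_eq (hf : IsParentFun ρ f) (hg : IsParentFun ρ g)
    (h : parentGraph f = parentGraph g) : f = g := by
  have hf' := hf
  obtain ⟨-, rank, hr⟩ := hf'
  have key : ∀ k v, rank v = k → f v = g v := by
    intro k
    induction k using Nat.strong_induction_on with
    | _ k ih =>
      intro v hk
      by_cases hv : v = ρ
      · rw [hv, hf.1, hg.1]
      · have hadj : (parentGraph f).Adj v (f v) :=
          parentGraph_adj.2 ⟨(hf.apply_ne hv).symm, Or.inl rfl⟩
        rw [h, parentGraph_adj] at hadj
        rcases hadj.2 with h' | h'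
        · exact h'.symm
        · rw [← ih _ (hk ▸ hr v hv) (f v) rfl] at h'
          exact absurd h' (hf.apply_apply_ne hv)
  exact funext fun v => key _ v rfl

/-- The parent is the next vertex on a shortest walk to the root. The resulting graph is a connected
subgraph of `T`, and a tree is minimally connected. -/
theorem SimpleGraph.IsTree.exists_parentGraph_eq {T : SimpleGraph V} (hT : T.IsTree) (ρ : V) :
    ∃ f, IsParentFun ρ f ∧ parentGraph f = T := by
  classical
  have step : ∀ v, v ≠ ρ → ∃ u, T.Adj v u ∧ T.dist u ρ < T.dist v ρ := by
    intro v hv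
    obtain ⟨p, hp⟩ := (hT.connected v ρ).exists_walk_length_eq_dist
    cases p with
    | nil => exact absurd rfl hv
    | cons hadj q =>
      refine ⟨_, hadj, ?_⟩
      rw [← hp, SimpleGraph.Walk.length_cons]
      exact Nat.lt_succ_of_le (SimpleGraph.dist_le q)
  choose! p hp using step
  have hf : IsParentFun ρ (fun v => if v = ρ then ρ else p v) := by
    refine ⟨if_pos rfl, fun v => T.dist v ρ, fun v hv => ?_⟩
    simp only [if_neg hv]
    exact (hp v hv).2
  refine ⟨_, hf, ?_⟩
  have hle : parentGraph (fun v => if v = ρ then ρ else p v) ≤ T := by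
    rw [hf.parentGraph_le]
    intro v hv
    simp only [if_neg hv]
    exact (hp v hv).1
  exact le_antisymm hle
    ((SimpleGraph.isTree_iff_minimal_connected.1 hT).2 hf.parentGraph_connected hle)

/-- Each edge joins exactly one non-root vertex to its parent, and the neighbours of `v` are its
parent, if any, and its children, disjointly. -/
theorem IsParentFun.prod_pow_degree [Fintype V] [DecidableEq V] {R : Type*} [CommMonoid R]
    (hf : IsParentFun ρ f) (s : V → R) [∀ v, Fintype ((parentGraph f).neighborSet v)] :
    ∏ v, s v ^ (parentGraph f).degree v = ∏ v ∈ Finset.univ.erase ρ, s v * s (f v) := by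
  have hdeg : ∀ v, s v ^ (parentGraph f).degree v =
      (if v = ρ then 1 else s v) * ∏ u ∈ Finset.univ.erase ρ, if f u = v then s v else 1 := by
    intro v
    have hset : (parentGraph f).neighborFinset v =
        (if v = ρ then ∅ else {f v}) ∪ (Finset.univ.erase ρ).filter (fun u => f u = v) := by
      ext u
      rw [SimpleGraph.mem_neighborFinset, parentGraph_adj]
      by_cases hv : v = ρ
      · subst hv
        simp only [if_pos, Finset.empty_union, Finset.mem_filter, Finset.mem_erase,
          Finset.mem_univ, and_true, hf.1]
        tauto
      · simp only [if_neg hv, Finset.mem_union, Finset.mem_singleton, Finset.mem_filter,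
          Finset.mem_erase, Finset.mem_univ, and_true]
        constructor
        · rintro ⟨hne, h | h⟩
          · exact Or.inl h.symm
          · refine Or.inr ⟨?_, h⟩
            rintro rfl
            exact hne (h.symm.trans hf.1)
        · rintro (h | ⟨h, h'⟩)
          · exact ⟨h ▸ (hf.apply_ne hv).symm, Or.inl h.symm⟩
          · exact ⟨h' ▸ hf.apply_ne h, Or.inr h'⟩
    have hdisj : Disjoint (if v = ρ then ∅ else {f v})
        ((Finset.univ.erase ρ).filter (fun u => f u = v)) := by
      split_ifs with hv
      · exact Finset.disjoint_empty_left _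
      · rw [Finset.disjoint_singleton_left]
        simp only [Finset.mem_filter, not_and]
        exact fun _ => hf.apply_apply_ne hv
    rw [← SimpleGraph.card_neighborFinset_eq_degree, hset, Finset.card_union_of_disjoint hdisj,
      pow_add, Finset.prod_ite, Finset.prod_const, Finset.prod_const_one, mul_one]
    split_ifs <;> simp
  rw [Finset.prod_congr rfl fun v _ => hdeg v, Finset.prod_mul_distrib, Finset.prod_comm,
    Finset.prod_mul_distrib]
  congr 1
  · rw [← Finset.mul_prod_erase _ _ (Finset.mem_univ ρ), if_pos rfl, one_mul]
    exact Finset.prod_congr rfl fun v hv => if_neg (Finset.ne_of_mem_erase hv)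
  · exact Finset.prod_congr rfl fun u _ => by simp

end ParentGraph

/-! ### Weighted matrix-tree theorem -/

section Determinants

open Matrix

/-- Triangularity with ties allowed in the order. A permutation preserves the total rank, so a
nontrivial one cannot raise the rank at every point it moves; its term contains a zero. -/
theorem Matrix.det_eq_prod_diag_of_rank {ι R : Type*} [Fintype ι] [DecidableEq ι] [CommRing R]
    (A : Matrix ι ι R) (rank : ι → ℕ) (h : ∀ i j, i ≠ j → rank i ≤ rank j → A i j = 0) :
    A.det = ∏ i, A i i := by
  rw [det_apply, Finset.sum_eq_single 1]
  · simp
  · intro σ _ hσ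
    have : ∃ i, σ i ≠ i ∧ rank (σ i) ≤ rank i := by
      by_contra! hcon
      obtain ⟨i, hi⟩ : ∃ i, σ i ≠ i := by
        by_contra! h'
        exact hσ (Equiv.ext h')
      have hlt : ∑ i, rank i < ∑ i, rank (σ i) := by
        refine Finset.sum_lt_sum (fun j _ => ?_) ⟨i, Finset.mem_univ _, hcon i hi⟩
        by_cases hj : σ j = j
        · rw [hj]
        · exact (hcon j hj).le
      rw [Equiv.sum_comp σ rank] at hlt
      exact lt_irrefl _ hlt
    obtain ⟨i, hi, hr⟩ := this
    have hz : ∏ i, A (σ i) i = 0 := Finset.prod_eq_zero (Finset.mem_univ i) (h _ _ hi hr)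
    rw [hz, smul_zero]
  · simp

variable {V : Type*} [Fintype V] [DecidableEq V]

/-- The matrix of the map `x ↦ (v ↦ x v - x (f v))`, with the row of `ρ` replaced by
`x ↦ x ρ`. -/
def functionalMatrix (ρ : V) (f : V → V) : Matrix V V ℚ :=
  fun v => if v = ρ then Pi.single ρ 1 else Pi.single v 1 - Pi.single (f v) 1

theorem IsParentFun.det_functionalMatrix {ρ : V} {f : V → V} (hf : IsParentFun ρ f) :
    (functionalMatrix ρ f).det = 1 := by
  have hf' := hf
  obtain ⟨h0, rank, hr⟩ := hf'
  rw [det_eq_prod_diag_of_rank _ (fun v => if v = ρ then 0 else rank v + 1)]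
  · refine Finset.prod_eq_one fun v _ => ?_
    by_cases hv : v = ρ
    · simp [functionalMatrix, hv]
    · simp [functionalMatrix, hv, (hf.apply_ne hv).symm]
  · intro v u hne hle
    by_cases hv : v = ρ
    · subst hv
      simp [functionalMatrix, hne.symm]
    · have hu : u ≠ ρ := by
        rintro rfl
        simp [hv] at hle
      have hfu : u ≠ f v := by
        rintro rfl
        have := hr v hv
        simp only [if_neg hv, if_neg hu] at hle
        omega
      simp [functionalMatrix, hv, hne.symm, hfu]

theorem det_functionalMatrix_eq_zero {ρ : V} {f : V → V} (h0 : f ρ = ρ)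
    (hf : ¬ IsParentFun ρ f) : (functionalMatrix ρ f).det = 0 := by
  classical
  have hex : ∃ v, ∀ k, f^[k] v ≠ ρ := by
    by_contra! hcon
    refine hf ⟨h0, fun v => Nat.find (hcon v), fun v hv => ?_⟩
    have hpos : Nat.find (hcon v) ≠ 0 := by
      intro hz
      have := Nat.find_spec (hcon v)
      rw [hz] at this
      exact hv this
    obtain ⟨k, hk⟩ := Nat.exists_eq_succ_of_ne_zero hpos
    have hspec := Nat.find_spec (hcon v)
    rw [hk, Function.iterate_succ_apply] at hspec
    have := Nat.find_min' (hcon (f v)) hspec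
    change Nat.find (hcon (f v)) < Nat.find (hcon v)
    omega
  have hstep : ∀ v, (∀ k, f^[k] (f v) ≠ ρ) ↔ ∀ k, f^[k] v ≠ ρ := by
    intro v
    constructor
    · intro h k
      cases k with
      | zero =>
        rintro hv
        exact h 0 (by rw [show v = ρ from hv]; exact h0)
      | succ k => exact h k
    · exact fun h k => h (k + 1)
  rw [← exists_mulVec_eq_zero_iff]
  -- The vertices whose orbit misses the root form a nonempty set, and `v` lies in it iff `f v`
  -- does, so its indicator is a kernel vector.
  refine ⟨fun v => if ∀ k, f^[k] v ≠ ρ then 1 else 0, ?_, ?_⟩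
  · obtain ⟨v, hv⟩ := hex
    intro h
    have := congrFun h v
    simp only [if_pos hv] at this
    exact one_ne_zero this
  · funext v
    by_cases hv : v = ρ
    · subst hv
      have : ¬ ∀ k, f^[k] v ≠ v := fun h => h 0 rfl
      simp only [mulVec, functionalMatrix, if_true, single_dotProduct, if_neg this]
      simp
    · simp only [mulVec, functionalMatrix, if_neg hv, sub_dotProduct, single_dotProduct,
        hstep v]
      simp

/-- The Laplacian of `G` with weight `s u` on the dart `(v, u)`, with the row of `ρ` replaced by
a unit vector. -/
def rootedLaplacian (G : SimpleGraph V) [DecidableRel G.Adj] (ρ : V) (s : V → ℚ) : Matrix V V ℚ :=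
  fun v => if v = ρ then Pi.single ρ 1
    else ∑ u, (if G.Adj v u then s u else 0) • (Pi.single v 1 - Pi.single u 1)

/-- Multilinearity in the rows gives one term per function `f : V → V`, a multiple of the
determinant of `functionalMatrix ρ f`, which is 1 for parent functions and 0 for other `f` fixing
`ρ`. -/
theorem det_rootedLaplacian (G : SimpleGraph V) [DecidableRel G.Adj] (ρ : V) (s : V → ℚ)
    [DecidablePred (IsParentFun (V := V) ρ)] :
    (rootedLaplacian G ρ s).det =
      ∑ f : V → V with IsParentFun ρ f ∧ ∀ v, v ≠ ρ → G.Adj v (f v),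
        ∏ v ∈ Finset.univ.erase ρ, s (f v) := by
  have hrow : rootedLaplacian G ρ s = fun v => ∑ u,
      -- The root row is written as a sum too, with coefficients that kill every `f` not fixing `ρ`.
      (if v = ρ then (if u = ρ then 1 else 0) else (if G.Adj v u then s u else 0)) •
        (if v = ρ then Pi.single ρ 1 else Pi.single v 1 - Pi.single u 1 : V → ℚ) := by
    funext v
    by_cases hv : v = ρ
    · simp only [rootedLaplacian, if_pos hv, ite_smul, one_smul, zero_smul, Finset.sum_ite_eq',
        Finset.mem_univ, if_true]
    · simp only [rootedLaplacian, if_neg hv]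
  have hexp := MultilinearMap.map_sum
    ((detRowAlternating : (V → ℚ) [⋀^V]→ₗ[ℚ] ℚ).toMultilinearMap)
    (fun v u : V =>
      (if v = ρ then (if u = ρ then (1 : ℚ) else 0) else (if G.Adj v u then s u else 0)) •
        (if v = ρ then Pi.single ρ 1 else Pi.single v 1 - Pi.single u 1 : V → ℚ))
  have hdet : (rootedLaplacian G ρ s).det = _ := (congrArg Matrix.det hrow).trans hexp
  rw [hdet, Finset.sum_filter]
  refine Finset.sum_congr rfl fun f _ => ?_
  rw [MultilinearMap.map_smul_univ]
  change _ • (functionalMatrix ρ f).det = _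
  rw [← Finset.mul_prod_erase _ _ (Finset.mem_univ ρ), if_pos rfl]
  have hprod : ∏ v ∈ Finset.univ.erase ρ,
      (if v = ρ then (if f v = ρ then (1 : ℚ) else 0) else (if G.Adj v (f v) then s (f v) else 0))
      = ∏ v ∈ Finset.univ.erase ρ, (if G.Adj v (f v) then s (f v) else 0) :=
    Finset.prod_congr rfl fun v hv => if_neg (Finset.ne_of_mem_erase hv)
  rw [hprod]
  by_cases hadj : ∀ v, v ≠ ρ → G.Adj v (f v)
  · have hprod' : ∏ v ∈ Finset.univ.erase ρ, (if G.Adj v (f v) then s (f v) else 0) =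
        ∏ v ∈ Finset.univ.erase ρ, s (f v) :=
      Finset.prod_congr rfl fun v hv => if_pos (hadj v (Finset.ne_of_mem_erase hv))
    rw [hprod']
    by_cases hf : IsParentFun ρ f
    · rw [hf.det_functionalMatrix, if_pos hf.1, if_pos ⟨hf, hadj⟩, one_mul, smul_eq_mul, mul_one]
    · rw [if_neg (c := IsParentFun ρ f ∧ _) fun h => hf h.1]
      by_cases h0 : f ρ = ρ
      · rw [det_functionalMatrix_eq_zero h0 hf, smul_zero]
      · rw [if_neg h0, zero_mul, zero_smul]
  · rw [if_neg (c := IsParentFun ρ f ∧ _) fun h => hadj h.2]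
    push Not at hadj
    obtain ⟨v, hv, hn⟩ := hadj
    rw [Finset.prod_eq_zero (Finset.mem_erase.2 ⟨hv, Finset.mem_univ v⟩) (if_neg hn), mul_zero,
      zero_smul]

open Classical in
/-- The matrix-tree theorem for the weights `s u * s v`. -/
theorem sum_spanningTrees_prod_pow_degree (G : SimpleGraph V) [DecidableRel G.Adj] (ρ : V)
    (s : V → ℚ) :
    ∑ T : SimpleGraph V with T ≤ G ∧ T.IsTree, ∏ v, s v ^ T.degree v =
      (∏ v ∈ Finset.univ.erase ρ, s v) * (rootedLaplacian G ρ s).det := by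
  rw [det_rootedLaplacian, Finset.mul_sum]
  symm
  refine Finset.sum_bij (fun f _ => parentGraph f) ?_ ?_ ?_ ?_
  · intro f hf
    simp only [Finset.mem_filter, Finset.mem_univ, true_and] at hf ⊢
    exact ⟨hf.1.parentGraph_le.2 hf.2, hf.1.parentGraph_isTree⟩
  · intro f hf g hg h
    simp only [Finset.mem_filter, Finset.mem_univ, true_and] at hf hg
    exact hf.1.eq_of_parentGraph_eq hg.1 h
  · intro T hT
    simp only [Finset.mem_filter, Finset.mem_univ, true_and] at hT
    obtain ⟨f, hf, rfl⟩ := hT.2.exists_parentGraph_eq ρ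
    refine ⟨f, ?_, rfl⟩
    simp only [Finset.mem_filter, Finset.mem_univ, true_and]
    exact ⟨hf, hf.parentGraph_le.1 hT.1⟩
  · intro f hf
    simp only [Finset.mem_filter, Finset.mem_univ, true_and] at hf
    rw [hf.1.prod_pow_degree, Finset.prod_mul_distrib]

end Determinants

/-! ### Averaging over signs and counting by blocks -/

section SignVectors

theorem Int.units_coe_rat_eq (u : ℤˣ) : ((u : ℤ) : ℚ) = 2 * (if u = 1 then 1 else 0) - 1 := by
  rcases Int.units_eq_one_or u with rfl | rfl
  · norm_num
  · have : ¬ ((-1 : ℤˣ) = 1) := by decide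
    rw [if_neg this]
    norm_num

theorem sum_units_int_pow_succ (d : ℕ) :
    ∑ u : ℤˣ, ((u : ℤ) : ℚ) * ((u : ℤ) : ℚ) ^ d = if Odd d then 2 else 0 := by
  rw [show (Finset.univ : Finset ℤˣ) = {1, -1} from rfl, Finset.sum_pair (by decide)]
  split_ifs with h
  · simp [h.neg_one_pow]
    norm_num
  · simp [(Nat.not_odd_iff_even.1 h).neg_one_pow]

open Classical in
/-- Averaging the degree enumerator of spanning trees over all signs of the vertices singles out
the odd spanning trees. -/
theorem two_pow_card_mul_numOddSpanningTrees {V : Type*} [Fintype V] (G : SimpleGraph V) :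
    (2 : ℚ) ^ Fintype.card V * numOddSpanningTrees G =
      ∑ ε : V → ℤˣ, (∏ v, ((ε v : ℤ) : ℚ)) *
        ∑ T : SimpleGraph V with T ≤ G ∧ T.IsTree, ∏ v, ((ε v : ℤ) : ℚ) ^ T.degree v := by
  have hT : ∀ T : SimpleGraph V, ∑ ε : V → ℤˣ, (∏ v, ((ε v : ℤ) : ℚ)) *
      ∏ v, ((ε v : ℤ) : ℚ) ^ T.degree v =
      if ∀ v, Odd (T.degree v) then 2 ^ Fintype.card V else 0 := by
    intro T
    simp_rw [← Finset.prod_mul_distrib]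
    rw [← Fintype.piFinset_univ, ← Finset.prod_univ_sum (fun _ => Finset.univ)
      (fun v (u : ℤˣ) => ((u : ℤ) : ℚ) * ((u : ℤ) : ℚ) ^ T.degree v)]
    simp_rw [sum_units_int_pow_succ]
    split_ifs with h
    · rw [Finset.prod_congr rfl fun v _ => if_pos (h v), Finset.prod_const, Finset.card_univ]
    · push Not at h
      obtain ⟨v, hv⟩ := h
      exact Finset.prod_eq_zero (Finset.mem_univ v) (if_neg hv)
  simp_rw [Finset.mul_sum]
  rw [Finset.sum_comm, Finset.sum_congr rfl fun T _ => hT T, ← Finset.sum_filter,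
    Finset.sum_const, Finset.filter_filter, nsmul_eq_mul, mul_comm, numOddSpanningTrees,
    ← Set.ncard_coe_finset]
  congr 3
  ext T
  simp [and_assoc]

/-- A sign vector amounts to an independent choice of its positive set inside each fibre of `b`. -/
theorem card_sign_vectors_with_fiber_counts {ι κ : Type*} [Fintype ι] [Fintype κ] [DecidableEq ι]
    [DecidableEq κ] (b : ι → κ) (k : κ → ℕ) :
    (Finset.univ.filter fun ε : ι → ℤˣ =>
      (fun t => (Finset.univ.filter fun j => b j = t ∧ ε j = 1).card) = k).card =
      ∏ t, (Finset.univ.filter fun j => b j = t).card.choose (k t) := by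
  have hR : ∏ t, (Finset.univ.filter fun j => b j = t).card.choose (k t) =
      (Fintype.piFinset fun t =>
        Finset.powersetCard (k t) (Finset.univ.filter fun j => b j = t)).card := by
    rw [Fintype.card_piFinset]
    exact Finset.prod_congr rfl fun t _ => (Finset.card_powersetCard _ _).symm
  rw [hR]
  have hne : ¬ ((-1 : ℤˣ) = 1) := by decide
  refine Finset.card_nbij' (fun ε t => Finset.univ.filter fun j => b j = t ∧ ε j = 1)
    (fun S j => if j ∈ S (b j) then 1 else -1) ?_ ?_ ?_ ?_
  · intro ε hε
    rw [Finset.mem_coe, Finset.mem_filter] at hε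
    rw [Finset.mem_coe, Fintype.mem_piFinset]
    intro t
    rw [Finset.mem_powersetCard]
    refine ⟨fun j hj => ?_, congrFun hε.2 t⟩
    simp only [Finset.mem_filter, Finset.mem_univ, true_and] at hj ⊢
    exact hj.1
  · intro S hS
    rw [Finset.mem_coe, Fintype.mem_piFinset] at hS
    rw [Finset.mem_coe, Finset.mem_filter]
    refine ⟨Finset.mem_univ _, funext fun t => ?_⟩
    obtain ⟨h1, h2⟩ := Finset.mem_powersetCard.1 (hS t)
    rw [← h2]
    congr 1
    ext j
    simp only [Finset.mem_filter, Finset.mem_univ, true_and, ite_eq_left_iff, hne, imp_false,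
      not_not]
    constructor
    · rintro ⟨rfl, h⟩
      exact h
    · intro h
      have := h1 h
      simp only [Finset.mem_filter, Finset.mem_univ, true_and] at this
      exact ⟨this, this ▸ h⟩
  · intro ε _
    funext j
    rcases Int.units_eq_one_or (ε j) with h | h
    · simp [h]
    · simp [h, hne]
  · intro S hS
    rw [Finset.mem_coe, Fintype.mem_piFinset] at hS
    funext t
    obtain ⟨h1, -⟩ := Finset.mem_powersetCard.1 (hS t)
    ext j
    simp only [Finset.mem_filter, Finset.mem_univ, true_and, ite_eq_left_iff, hne, imp_false,
      not_not]
    constructor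
    · rintro ⟨rfl, h⟩
      exact h
    · intro h
      have := h1 h
      simp only [Finset.mem_filter, Finset.mem_univ, true_and] at this
      exact ⟨this, this ▸ h⟩

theorem partDiff_card_le {m : ℕ} {ι : Type*} [Fintype ι] (b : ι → Fin m) (i : Fin m) :
    partDiff (fun i => (Finset.univ.filter fun j => i ≤ b j).card) i =
      (Finset.univ.filter fun j => b j = i).card := by
  classical
  have hsplit : (Finset.univ.filter fun j => i ≤ b j) =
      (Finset.univ.filter fun j => b j = i) ∪ (Finset.univ.filter fun j => i < b j) := by
    ext j
    simp only [Finset.mem_union, Finset.mem_filter, Finset.mem_univ, true_and]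
    rw [le_iff_eq_or_lt, eq_comm]
  have hdisj : Disjoint (Finset.univ.filter fun j => b j = i)
      (Finset.univ.filter fun j => i < b j) := by
    rw [Finset.disjoint_filter]
    exact fun j _ h h' => h'.ne' h
  have hlt : (if h : (i : ℕ) + 1 < m then
      (Finset.univ.filter fun j => (⟨i + 1, h⟩ : Fin m) ≤ b j).card else 0) =
      (Finset.univ.filter fun j => i < b j).card := by
    split_ifs with h
    · rfl
    · symm
      rw [Finset.card_eq_zero, Finset.filter_eq_empty_iff]
      intro j _ hj
      have := (b j).isLt
      have : (i : ℕ) < b j := hj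
      omega
  rw [partDiff, hlt]
  simp only [hsplit, Finset.card_union_of_disjoint hdisj]
  omega

/-- Sums over sign vectors of a function of the partial sums over the rows of a Ferrers shape,
grouped by the number of positive signs in each block of equal columns. -/
theorem sum_sign_vectors_ferrers {m : ℕ} {ι : Type*} [Fintype ι] [DecidableEq ι]
    (E : Fin (m + 1) → ι → Prop) [∀ i, DecidablePred (E i)] (h0 : ∀ j, E 0 j)
    (hE : ∀ i i' j, i ≤ i' → E i' j → E i j) (lam : Fin (m + 1) → ℕ)
    (hlam : ∀ i, lam i = (Finset.univ.filter fun j => E i j).card)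
    (F : (Fin (m + 1) → ℚ) → ℚ) :
    ∑ ε : ι → ℤˣ, F (fun i => ∑ j, if E i j then ((ε j : ℤ) : ℚ) else 0) =
      ∑ k ∈ Fintype.piFinset (fun t => Finset.Icc 0 (partDiff lam t)),
        (∏ t, ((partDiff lam t).choose (k t) : ℚ)) *
          F (fun i => 2 * ∑ t ∈ Finset.Ici i, (k t : ℚ) - (lam i : ℚ)) := by
  -- Each column is an initial segment of rows, nonempty by `h0`; `b j` will be its last row.
  have hb : ∀ j, ∃ t, ∀ i, E i j ↔ i ≤ t := by
    intro j
    have hne : (Finset.univ.filter fun i => E i j).Nonempty := ⟨0, by simp [h0 j]⟩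
    refine ⟨Finset.max' _ hne, fun i => ⟨fun h => Finset.le_max' _ _ (by simp [h]), fun h => ?_⟩⟩
    have := Finset.max'_mem _ hne
    rw [Finset.mem_filter] at this
    exact hE _ _ _ h this.2
  choose b hb using hb
  simp_rw [hb] at hlam ⊢
  obtain rfl : lam = fun i => (Finset.univ.filter fun j => i ≤ b j).card := funext hlam
  simp_rw [partDiff_card_le]
  have hmaps : ∀ ε ∈ (Finset.univ : Finset (ι → ℤˣ)),
      (fun t => (Finset.univ.filter fun j => b j = t ∧ ε j = 1).card) ∈
        Fintype.piFinset fun t => Finset.Icc 0 (Finset.univ.filter fun j => b j = t).card := by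
    intro ε _
    rw [Fintype.mem_piFinset]
    intro t
    rw [Finset.mem_Icc]
    refine ⟨Nat.zero_le _, Finset.card_le_card fun j hj => ?_⟩
    simp only [Finset.mem_filter, Finset.mem_univ, true_and] at hj ⊢
    exact hj.1
  rw [← Finset.sum_fiberwise_of_maps_to hmaps]
  refine Finset.sum_congr rfl fun k _ => ?_
  have hconst : ∀ ε ∈ Finset.univ.filter (fun ε : ι → ℤˣ =>
      (fun t => (Finset.univ.filter fun j => b j = t ∧ ε j = 1).card) = k),
      F (fun i => ∑ j, if i ≤ b j then ((ε j : ℤ) : ℚ) else 0) =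
      F (fun i => 2 * ∑ t ∈ Finset.Ici i, (k t : ℚ) -
        ((Finset.univ.filter fun j => i ≤ b j).card : ℚ)) := by
    intro ε hε
    rw [Finset.mem_filter] at hε
    congr 1
    funext i
    rw [← hε.2]
    have hcount : ∑ t ∈ Finset.Ici i,
        ((Finset.univ.filter fun j => b j = t ∧ ε j = 1).card : ℚ) =
        ∑ j ∈ Finset.univ.filter (fun j => i ≤ b j), if ε j = 1 then (1 : ℚ) else 0 := by
      rw [← Finset.sum_fiberwise_of_maps_to (g := b) (t := Finset.Ici i)
        (fun j hj => Finset.mem_Ici.2 (Finset.mem_filter.1 hj).2)]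
      refine Finset.sum_congr rfl fun t ht => ?_
      rw [Finset.mem_Ici] at ht
      rw [Finset.sum_boole, Finset.filter_filter, Finset.filter_filter]
      congr 2
      ext j
      simp only [Finset.mem_filter, Finset.mem_univ, true_and]
      constructor
      · rintro ⟨rfl, h⟩
        exact ⟨ht, rfl, h⟩
      · rintro ⟨-, h⟩
        exact h
    rw [hcount, ← Finset.sum_filter, Finset.mul_sum, Finset.card_eq_sum_ones, Nat.cast_sum,
      ← Finset.sum_sub_distrib]
    refine Finset.sum_congr rfl fun j _ => ?_
    rw [Int.units_coe_rat_eq, Nat.cast_one]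
  rw [Finset.sum_congr rfl hconst, Finset.sum_const, card_sign_vectors_with_fiber_counts,
    nsmul_eq_mul, Nat.cast_prod]

end SignVectors

/-! ### The Laplacian determinant of a Ferrers graph -/

section Ferrers

open Matrix

theorem rootedLaplacian_apply {V : Type*} [Fintype V] [DecidableEq V] (G : SimpleGraph V)
    [DecidableRel G.Adj] (ρ : V) (s : V → ℚ) (v w : V) :
    rootedLaplacian G ρ s v w =
      if v = ρ then (if w = ρ then 1 else 0)
      else (if w = v then ∑ u, if G.Adj v u then s u else 0 else 0) -
        if G.Adj v w then s w else 0 := by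
  by_cases hv : v = ρ
  · simp [rootedLaplacian, hv, Pi.single_apply]
  · simp only [rootedLaplacian, if_neg hv, Finset.sum_apply, Pi.smul_apply, Pi.sub_apply,
      smul_eq_mul, mul_sub, Finset.sum_sub_distrib, ← Finset.sum_mul, Pi.single_apply]
    simp

/-- Non-root Laplacian rows sum to zero, so omitting the root column leaves minus the root entry. -/
theorem sum_ne_root_rootedLaplacian {V : Type*} [Fintype V] [DecidableEq V] (G : SimpleGraph V)
    [DecidableRel G.Adj] (ρ : V) (s : V → ℚ) (v : V) :
    ∑ w, (if w = ρ then (0 : ℚ) else 1) • rootedLaplacian G ρ s v w =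
      if G.Adj v ρ then (if v = ρ then 0 else s ρ) else 0 := by
  have hsum : ∑ w, (if w = ρ then (0 : ℚ) else 1) • rootedLaplacian G ρ s v w =
      ∑ w, rootedLaplacian G ρ s v w - rootedLaplacian G ρ s v ρ := by
    rw [← Finset.sum_erase_eq_sub (Finset.mem_univ ρ), ← Finset.add_sum_erase _ _
      (Finset.mem_univ ρ), if_pos rfl, zero_smul, zero_add]
    exact Finset.sum_congr rfl fun w hw => by rw [if_neg (Finset.ne_of_mem_erase hw), one_smul]
  rw [hsum]
  simp_rw [rootedLaplacian_apply]
  by_cases hv : v = ρ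
  · subst hv
    simp
  · simp [hv, Ne.symm hv]

variable {V : Type*} {G : SimpleGraph V} {m n : ℕ}

namespace IsFerrersGraph

section

variable {r : Fin m → V} {c : Fin n → V}

theorem row_injective (hG : IsFerrersGraph G r c) : Function.Injective r := fun i i' h =>
  Sum.inl_injective (hG.partition.1 (a₁ := Sum.inl i) (a₂ := Sum.inl i') h)

theorem col_injective (hG : IsFerrersGraph G r c) : Function.Injective c := fun i i' h =>
  Sum.inr_injective (hG.partition.1 (a₁ := Sum.inr i) (a₂ := Sum.inr i') h)

theorem row_ne_col (hG : IsFerrersGraph G r c) (i : Fin m) (j : Fin n) : r i ≠ c j := fun h =>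
  Sum.inl_ne_inr (hG.partition.1 (a₁ := Sum.inl i) (a₂ := Sum.inr j) h)

theorem not_adj_row_row (hG : IsFerrersGraph G r c) (i i' : Fin m) : ¬ G.Adj (r i) (r i') := by
  intro h
  obtain ⟨j, hj⟩ := hG.bipartite.mem_of_mem_adj ⟨i, rfl⟩ h
  exact hG.row_ne_col i' j hj.symm

theorem not_adj_col_col (hG : IsFerrersGraph G r c) (j j' : Fin n) : ¬ G.Adj (c j) (c j') := by
  intro h
  obtain ⟨i, hi⟩ := hG.bipartite.symm.mem_of_mem_adj ⟨j, rfl⟩ h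
  exact hG.row_ne_col i j' hi

/-- The vertices of a Ferrers graph are its rows and columns. -/
noncomputable def equiv (hG : IsFerrersGraph G r c) : Fin m ⊕ Fin n ≃ V :=
  Equiv.ofBijective _ hG.partition

theorem equiv_inl (hG : IsFerrersGraph G r c) (i : Fin m) : hG.equiv (Sum.inl i) = r i := rfl

theorem equiv_inr (hG : IsFerrersGraph G r c) (j : Fin n) : hG.equiv (Sum.inr j) = c j := rfl

theorem sum_univ [Fintype V] {M : Type*} [AddCommMonoid M] (hG : IsFerrersGraph G r c)
    (F : V → M) : ∑ v, F v = ∑ i, F (r i) + ∑ j, F (c j) := by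
  rw [← hG.equiv.sum_comp, Fintype.sum_sum_type]
  rfl

theorem prod_univ [Fintype V] {M : Type*} [CommMonoid M] (hG : IsFerrersGraph G r c)
    (F : V → M) : ∏ v, F v = (∏ i, F (r i)) * ∏ j, F (c j) := by
  rw [← hG.equiv.prod_comp, Fintype.prod_sum_type]
  rfl

theorem card_vert [Fintype V] (hG : IsFerrersGraph G r c) : Fintype.card V = m + n := by
  rw [← Fintype.card_congr hG.equiv]
  simp

theorem degree_row [Fintype V] [DecidableRel G.Adj] (hG : IsFerrersGraph G r c) (i : Fin m) :
    G.degree (r i) = (Finset.univ.filter fun j => G.Adj (r i) (c j)).card := by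
  rw [← SimpleGraph.card_neighborFinset_eq_degree, SimpleGraph.neighborFinset_eq_filter,
    Finset.card_filter, hG.sum_univ, Finset.card_filter]
  simp [hG.not_adj_row_row]

theorem degree_col [Fintype V] [DecidableRel G.Adj] (hG : IsFerrersGraph G r c) (j : Fin n) :
    G.degree (c j) = (Finset.univ.filter fun i => G.Adj (r i) (c j)).card := by
  rw [← SimpleGraph.card_neighborFinset_eq_degree, SimpleGraph.neighborFinset_eq_filter,
    Finset.card_filter, hG.sum_univ, Finset.card_filter]
  simp [hG.not_adj_col_col, G.adj_comm (c j)]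

theorem adj_iff_lt [Fintype V] [DecidableRel G.Adj] (hG : IsFerrersGraph G r c) (i : Fin m)
    (j : Fin n) : G.Adj (r i) (c j) ↔ (j : ℕ) < G.degree (r i) := by
  rw [hG.degree_row]
  constructor
  · intro h
    have hsub : Finset.Iic j ⊆ Finset.univ.filter fun j => G.Adj (r i) (c j) := fun j' hj' => by
      rw [Finset.mem_filter]
      exact ⟨Finset.mem_univ _, hG.adj_of_le _ _ _ _ h le_rfl (Finset.mem_Iic.1 hj')⟩
    have := Finset.card_le_card hsub
    rw [Fin.card_Iic] at this
    omega
  · intro h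
    by_contra hn
    have hsub : (Finset.univ.filter fun j => G.Adj (r i) (c j)) ⊆ Finset.Iio j := fun j' hj' => by
      rw [Finset.mem_filter] at hj'
      rw [Finset.mem_Iio]
      by_contra hle
      exact hn (hG.adj_of_le _ _ _ _ hj'.2 le_rfl (not_lt.1 hle))
    have := Finset.card_le_card hsub
    rw [Fin.card_Iio] at this
    omega

end

variable {r : Fin (m + 1) → V} {c : Fin (n + 1) → V}

theorem adj_zero_col (hG : IsFerrersGraph G r c) (j : Fin (n + 1)) : G.Adj (r 0) (c j) :=
  hG.adj_of_le _ _ _ _ hG.adj_first_last (Fin.zero_le _) (Fin.le_last j)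

theorem adj_row_zero (hG : IsFerrersGraph G r c) (i : Fin (m + 1)) : G.Adj (r i) (c 0) :=
  hG.adj_of_le _ _ _ _ hG.adj_last_first (Fin.le_last i) (Fin.zero_le _)

theorem det_rootedLaplacian [Fintype V] [DecidableEq V] [DecidableRel G.Adj]
    (hG : IsFerrersGraph G r c) (s : V → ℚ) :
    (rootedLaplacian G (r 0) s).det =
      s (r 0) * (∏ i : Fin m, ∑ j, if G.Adj (r i.succ) (c j) then s (c j) else 0) *
        ∏ j : Fin n, ∑ i, if G.Adj (r i) (c j.succ) then s (r i) else 0 := by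
  set A := rootedLaplacian G (r 0) s with hA
  -- Adding all other non-root columns to column `c 0` makes it `s (r 0)` in the rows `c j` and zero
  -- in the rows `r i`.
  set A₁ := A.updateCol (c 0) (fun k => ∑ w, (if w = r 0 then (0 : ℚ) else 1) • A k w) with hA₁
  have hdet₁ : A₁.det = A.det := by
    rw [hA₁, det_updateCol_sum, if_neg (hG.row_ne_col 0 0).symm, one_smul]
  set κ : V → ℚ := fun v => Sum.elim (fun _ => 0) (fun j => if j = 0 then 0 else 1)
    (hG.equiv.symm v) with hκ
  have κr : ∀ i, κ (r i) = 0 := fun i => by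
    rw [hκ, ← hG.equiv_inl]; simp
  have κc : ∀ j, κ (c j) = if j = 0 then 0 else 1 := fun j => by
    rw [hκ, ← hG.equiv_inr]; simp
  -- Subtracting row `c 0` from each other row `c j` clears column `c 0` off the diagonal, and also
  -- the entry at `r i` whenever `r i` and `c j` are adjacent, since `c 0` is adjacent to every row
  -- vertex.
  set B : Matrix V V ℚ := fun v w => A₁ v w - κ v * A₁ (c 0) w with hB
  have hdet₂ : A₁.det = B.det := by
    refine det_eq_of_forall_row_eq_smul_add_const κ (c 0) (by simp [κc]) fun v w => ?_
    simp [hB, κc]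
  -- For `j ≠ 0` and `i ≠ 0`, `c j` ranks below `r i` exactly when they are adjacent, i.e. `j < deg
  -- (r i)`. The root comes first, and `c 0`, whose row is not cleared, comes last.
  set rank : V → ℕ := fun v => Sum.elim
    (fun i : Fin (m + 1) => if i = 0 then 0 else 2 * G.degree (r i) + 1)
    (fun j : Fin (n + 1) => if j = 0 then 2 * (n + 1) + 2 else 2 * (j : ℕ) + 2) (hG.equiv.symm v) with hrank
  have rank_r : ∀ i, rank (r i) = if i = 0 then 0 else 2 * G.degree (r i) + 1 := fun i => by
    simp only [hrank]
    rw [← hG.equiv_inl, Equiv.symm_apply_apply, Sum.elim_inl]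
    rfl
  have rank_c : ∀ j, rank (c j) = if j = 0 then 2 * (n + 1) + 2 else 2 * (j : ℕ) + 2 :=
    fun j => by
      simp only [hrank]
      rw [← hG.equiv_inr, Equiv.symm_apply_apply, Sum.elim_inr]
  have hA₁c0 : ∀ v, A₁ v (c 0) = if G.Adj v (r 0) then (if v = r 0 then 0 else s (r 0)) else 0 :=
    fun v => by rw [hA₁, updateCol_self, hA, sum_ne_root_rootedLaplacian]
  have hA₁ne : ∀ v w, w ≠ c 0 → A₁ v w = A v w := fun v w hw => by
    rw [hA₁, updateCol_ne hw]
  have hrr : ∀ i i', r i = r i' ↔ i = i' := fun _ _ => hG.row_injective.eq_iff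
  have hcc : ∀ j j', c j = c j' ↔ j = j' := fun _ _ => hG.col_injective.eq_iff
  have hcr : ∀ i j, c j ≠ r i := fun i j => (hG.row_ne_col i j).symm
  have hBr0 : ∀ i, B (r i) (c 0) = 0 := fun i => by
    simp [hB, hA₁c0, κr, hG.not_adj_row_row]
  have hBc0 : ∀ j, B (c j) (c 0) = if j = 0 then s (r 0) else 0 := fun j => by
    simp only [hB, hA₁c0, κc, (hG.adj_zero_col _).symm, if_true, if_neg (hcr _ _)]
    split_ifs <;> simp
  have hBrc : ∀ i j, j ≠ 0 → B (r i) (c j) =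
      if i = 0 then 0 else - if G.Adj (r i) (c j) then s (c j) else 0 := fun i j hj => by
    simp [hB, κr, hA₁ne _ _ (mt (hcc _ _).1 hj), hA, rootedLaplacian_apply, hrr, hcr]
  have hBrr : ∀ i i', B (r i) (r i') = if i = 0 then (if i' = 0 then 1 else 0) else
      if i' = i then ∑ u, if G.Adj (r i) u then s u else 0 else 0 := fun i i' => by
    simp [hB, κr, hA₁ne _ _ (hG.row_ne_col _ _), hA, rootedLaplacian_apply, hrr,
      hG.not_adj_row_row]
  have hBcr : ∀ i j, j ≠ 0 → G.Adj (r i) (c j) → B (c j) (r i) = 0 := fun i j hj hadj => by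
    simp [hB, κc, hj, hA₁ne _ _ (hG.row_ne_col _ _), hA, rootedLaplacian_apply,
      hG.row_ne_col, hcr, hadj.symm, (hG.adj_row_zero i).symm]
  have hBcc : ∀ j j', j ≠ 0 → j' ≠ 0 → B (c j) (c j') =
      if j' = j then ∑ u, if G.Adj (c j) u then s u else 0 else 0 := fun j j' hj hj' => by
    simp [hB, κc, hj, hA₁ne _ _ (mt (hcc _ _).1 hj'), hA, rootedLaplacian_apply,
      hcr, hcc, hG.not_adj_col_col, hj']
  rw [← hdet₁, hdet₂, det_eq_prod_diag_of_rank B rank, hG.prod_univ, Fin.prod_univ_succ,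
    Fin.prod_univ_succ]
  · have h1 : ∀ i : Fin m, B (r i.succ) (r i.succ) =
        ∑ j, if G.Adj (r i.succ) (c j) then s (c j) else 0 := fun i => by
      rw [hBrr, if_neg (Fin.succ_ne_zero i), if_pos rfl, hG.sum_univ]
      simp [hG.not_adj_row_row]
    have h2 : ∀ j : Fin n, B (c j.succ) (c j.succ) =
        ∑ i, if G.Adj (r i) (c j.succ) then s (r i) else 0 := fun j => by
      rw [hBcc _ _ (Fin.succ_ne_zero j) (Fin.succ_ne_zero j), if_pos rfl, hG.sum_univ]
      simp [hG.not_adj_col_col, G.adj_comm (c j.succ)]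
    rw [Finset.prod_congr rfl fun i _ => h1 i, Finset.prod_congr rfl fun j _ => h2 j, hBrr,
      if_pos rfl, if_pos rfl, hBc0, if_pos rfl]
    ring
  · intro v w
    obtain ⟨v, rfl⟩ := hG.equiv.surjective v
    obtain ⟨w, rfl⟩ := hG.equiv.surjective w
    intro hne hle
    have hdeg : ∀ i, G.degree (r i) ≤ n + 1 := fun i => by
      rw [hG.degree_row]
      exact (Finset.card_le_univ _).trans (by simp)
    rcases v with i | j <;> rcases w with i' | j' <;>
      simp only [hG.equiv_inl, hG.equiv_inr] at hne hle ⊢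
    · rw [rank_r, rank_r] at hle
      rw [hBrr]
      have hne' : i' ≠ i := fun h => hne (by rw [h])
      rw [if_neg hne']
      split_ifs with h1 h2
      · exact absurd (h2.trans h1.symm) hne'
      · rfl
      · rfl
    · by_cases hj' : j' = 0
      · rw [hj', hBr0]
      · rw [hBrc _ _ hj']
        rw [rank_r, rank_c, if_neg hj'] at hle
        split_ifs with h1 h2
        · rfl
        · rw [if_neg h1] at hle
          rw [hG.adj_iff_lt] at h2
          omega
        · exact neg_zero
    · rw [rank_c, rank_r] at hle
      have := hdeg i'
      by_cases hj : j = 0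
      · rw [if_pos hj] at hle
        split_ifs at hle <;> omega
      · rw [if_neg hj] at hle
        refine hBcr _ _ hj ?_
        rw [hG.adj_iff_lt]
        split_ifs at hle <;> omega
    · rw [rank_c, rank_c] at hle
      have hne' : j' ≠ j := fun h => hne (by rw [h])
      have hlt := j'.isLt
      by_cases hj' : j' = 0
      · rw [hj', hBc0, if_neg fun h => hne' (hj'.trans h.symm)]
      · by_cases hj : j = 0
        · rw [if_pos hj, if_neg hj'] at hle
          omega
        · rw [hBcc _ _ hj hj', if_neg hne']

end IsFerrersGraph

theorem Fin.prod_filter_one_le {n : ℕ} {M : Type*} [CommMonoid M] (F : Fin (n + 1) → M) :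
    ∏ i ∈ Finset.univ.filter (fun i : Fin (n + 1) => 1 ≤ (i : ℕ)), F i = ∏ i : Fin n, F i.succ := by
  rw [Finset.prod_filter, Fin.prod_univ_succ]
  simp

end Ferrers

/-! ### The formula for odd spanning trees -/

theorem mainTheorem5 {V : Type*} [Fintype V] (G : SimpleGraph V) [DecidableRel G.Adj]
    {m n : ℕ} (r : Fin m → V) (c : Fin n → V) (hG : IsFerrersGraph G r c)
    (hmn : Even (m + n))
    (lam : Fin m → ℕ) (hlam : ∀ i, lam i = G.degree (r i))
    (lam' : Fin n → ℕ) (hlam' : ∀ j, lam' j = G.degree (c j)) :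
    (numOddSpanningTrees G : ℚ) =
      1 / 2 ^ (m + n) *
        (∑ k ∈ Fintype.piFinset (fun t : Fin m => Finset.Icc 0 (partDiff lam t)),
          (∏ t, ((partDiff lam t).choose (k t) : ℚ)) *
            ∏ i ∈ Finset.univ.filter (fun i : Fin m => 1 ≤ (i : ℕ)), (2 * ∑ t ∈ Finset.Ici i, (k t : ℚ) - (lam i : ℚ))) *
        (∑ l ∈ Fintype.piFinset (fun s : Fin n => Finset.Icc 0 (partDiff lam' s)),
          (∏ s, ((partDiff lam' s).choose (l s) : ℚ)) *
            ∏ j ∈ Finset.univ.filter (fun j : Fin n => 1 ≤ (j : ℕ)), (2 * ∑ s ∈ Finset.Ici j, (l s : ℚ) - (lam' j : ℚ))) := by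
  classical
  obtain ⟨m, rfl⟩ := Nat.exists_eq_succ_of_ne_zero hG.rows_pos.ne'
  obtain ⟨n, rfl⟩ := Nat.exists_eq_succ_of_ne_zero hG.cols_pos.ne'
  have hrow := sum_sign_vectors_ferrers (fun i j => G.Adj (r i) (c j)) hG.adj_zero_col
    (fun i i' j hi h => hG.adj_of_le _ _ _ _ h hi le_rfl) lam
    (fun i => (hlam i).trans (hG.degree_row i))
    (fun y => ∏ i ∈ Finset.univ.filter (fun i : Fin (m + 1) => 1 ≤ (i : ℕ)), y i)
  have hcol := sum_sign_vectors_ferrers (fun j i => G.Adj (r i) (c j)) hG.adj_row_zero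
    (fun j j' i hj h => hG.adj_of_le _ _ _ _ h le_rfl hj) lam'
    (fun j => (hlam' j).trans (hG.degree_col j))
    (fun y => ∏ j ∈ Finset.univ.filter (fun j : Fin (n + 1) => 1 ≤ (j : ℕ)), y j)
  have htree : ∀ ε : V → ℤˣ, (∏ v, ((ε v : ℤ) : ℚ)) *
      ∑ T : SimpleGraph V with T ≤ G ∧ T.IsTree, ∏ v, ((ε v : ℤ) : ℚ) ^ T.degree v =
      (∏ i : Fin m, ∑ j, if G.Adj (r i.succ) (c j) then ((ε (c j) : ℤ) : ℚ) else 0) *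
        ∏ j : Fin n, ∑ i, if G.Adj (r i) (c j.succ) then ((ε (r i) : ℤ) : ℚ) else 0 := by
    intro ε
    -- The matrix-tree prefactor lacks exactly the root sign, which the Ferrers determinant
    -- supplies.
    have hsq : (∏ v, ((ε v : ℤ) : ℚ)) * ((∏ v ∈ Finset.univ.erase (r 0), ((ε v : ℤ) : ℚ)) *
        ((ε (r 0) : ℤ) : ℚ)) = 1 := by
      rw [Finset.prod_erase_mul _ (fun v => ((ε v : ℤ) : ℚ)) (Finset.mem_univ (r 0)),
        ← Finset.prod_mul_distrib]
      refine Finset.prod_eq_one fun v _ => ?_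
      rcases Int.units_eq_one_or (ε v) with h | h <;> simp [h]
    rw [← mul_assoc] at hsq
    rw [sum_spanningTrees_prod_pow_degree G (r 0) (fun v => ((ε v : ℤ) : ℚ)),
      hG.det_rootedLaplacian, mul_assoc (((ε (r 0) : ℤ) : ℚ)), ← mul_assoc (∏ v ∈ _, _),
      ← mul_assoc, hsq, one_mul]
  have key := two_pow_card_mul_numOddSpanningTrees G
  rw [Finset.sum_congr rfl fun ε _ => htree ε, hG.card_vert] at key
  -- Splitting a sign vector into row signs and column signs makes the double sum a product.
  rw [← (hG.equiv.arrowCongr (Equiv.refl ℤˣ)).sum_comp,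
    ← (Equiv.sumArrowEquivProdArrow _ _ _).symm.sum_comp, Fintype.sum_prod_type] at key
  have hr : ∀ (x : Fin (m + 1) → ℤˣ) (y : Fin (n + 1) → ℤˣ) i,
      hG.equiv.arrowCongr (Equiv.refl ℤˣ) ((Equiv.sumArrowEquivProdArrow _ _ _).symm (x, y)) (r i) =
        x i := fun x y i => by
    rw [← hG.equiv_inl]; simp [Equiv.arrowCongr]
  have hc : ∀ (x : Fin (m + 1) → ℤˣ) (y : Fin (n + 1) → ℤˣ) j,
      hG.equiv.arrowCongr (Equiv.refl ℤˣ) ((Equiv.sumArrowEquivProdArrow _ _ _).symm (x, y)) (c j) =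
        y j := fun x y i => by
    rw [← hG.equiv_inr]; simp [Equiv.arrowCongr]
  simp_rw [hr, hc, ← Finset.sum_mul, ← Finset.mul_sum] at key
  simp_rw [Fin.prod_filter_one_le] at hrow hcol ⊢
  rw [hrow, hcol] at key
  rw [mul_assoc, ← key]
  simp
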